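/- \textbf{Proposition} (cardinality estimates). Let $\mathcal X$ be a finite set with at least two elements, $w:\mathcal X\times\mathcal X\to[0,\infty)$ a weight function which is reversible with respect to a probability measure $\mu$ on $\mathcal X$, i.e. $\mu(x)w(x,y)=\mu(y)w(y,x)$ for all $x,y\in\mathcal X$, and irreducible, i.e. any two points $x,y$ are linked by a sequence $x=x_0,\dots,x_k=y$ with $w(x_{i-1},x_i)>0$ for all $i$. Put $w(x)=\sum_{y\neq x}w(x,y)$ and $\alpha=\max_{x\in\mathcal X}w(x)>0$. Let $\mathcal L$ be the generator, i.e. the matrix with $\mathcal L(x,y)=w(x,y)$ for $x\ne y$ and $\mathcal L(x,x)=-w(x)$, and let $$m(\mathcal L)=\frac1{|\mathcal X|}\sum_{i=0}^{|\mathcal X|-1}\frac{\lambda_i}{\alpha},$$ where $\lambda_0,\dots,\lambda_{|\mathcal X|-1}$ are the (real) eigenvalues of $-\mathcal L$, counted with multiplicity. A spanning oriented forest $\phi$ is a graph without cycles with vertex set $\mathcal X$, all of whose edges $\{x,y\}$ satisfy $w(x,y)>0$ (and $w(y,x)>0$), together with the choice of one vertex, called the root, in each of its connected components; its edges are oriented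 toward the roots, and $\rho(\phi)$ denotes the set of its roots. For $q>0$, let $\pi_q$ be the probability measure on spanning oriented forests given by $$\pi_q(\phi)=\frac{1}{Z(q)}\,q^{|\rho(\phi)|}\prod_{(x,y)\in\phi}w(x,y),$$ where the product is over the oriented edges of $\phi$ and $Z(q)$ is the normalizing constant. Let $\Phi$ be a random spanning oriented forest with law $\pi_q$, defined on a probability space whose expectation is denoted by $\mathbb E_q$, and let $\bar{\mathcal X}=\rho(\Phi)$ and $\breve{\mathcal X}=\mathcal X\setminus\bar{\mathcal X}$. Then \begin{enumerate} \item $\mathbb E_q\big[|\bar{\mathcal X}|\big]\ \ge\ |\mathcal X|\,\dfrac{q}{q+\alpha}$. \item $\mathbb E_q\big[|\breve{\mathcal X}|\big]\ \ge\ |\mathcal X|\,\dfrac{\alpha}{q+2\alpha}\,m(\mathcal L)$. \item For every $r\in[0,1]$, with $\mathcal R_r=\{x\in\mathcal X:\ w(x)\ge r\alpha\}$, $$\mathbb E_q\big[|\breve{\mathcal X}\cap\mathcal R_r|\big]\ \ge\ |\mathcal R_r|\,\frac{r\alpha}{q+2\alpha}.$$ \end{enumerate} -/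

import Mathlib

open MeasureTheory ProbabilityTheory

namespace RandomForest

noncomputable section

/-- The rate of escape `w(x) = ∑_{y ≠ x} w(x, y)`. -/
def exitRate {X : Type*} [Fintype X] [DecidableEq X] (w : X → X → ℝ) (x : X) : ℝ :=
  ∑ y ∈ Finset.univ.erase x, w x y

/-- The maximal rate `α = max_x w(x)`. -/
def maxRate {X : Type*} [Fintype X] [DecidableEq X] [Nonempty X] (w : X → X → ℝ) : ℝ :=
  Finset.univ.sup' Finset.univ_nonempty (exitRate w)

/-- The generator `L` (graph Laplacian) as a matrix: `L(x, y) = w(x, y)` for `x ≠ y` and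
`L(x, x) = -w(x)`. -/
def generator {X : Type*} [Fintype X] [DecidableEq X] (w : X → X → ℝ) : Matrix X X ℝ :=
  Matrix.of fun x y => if x = y then -exitRate w x else w x y

/-- Irreducibility: any state can be reached from any other one through jumps of positive rate. -/
def IsIrreducible {X : Type*} (w : X → X → ℝ) : Prop :=
  ∀ x y : X, Relation.ReflTransGen (fun a b => 0 < w a b) x y

/-- The mean `m(L)` of the eigenvalues of `-L / α`, where the eigenvalues of `-L` are the roots of
its characteristic polynomial, listed with multiplicity. -/
def meanEigenvalue {X : Type*} [Fintype X] [DecidableEq X] [Nonempty X] (w : X → X → ℝ) : ℝ :=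
  (1 / (Fintype.card X : ℝ)) *
    ((-generator w).charpoly.roots.map fun eigenvalue => eigenvalue / maxRate w).sum

/-- The set `R_r` of rapid points, those with `w(x) ≥ r α`. -/
def rapidPoints {X : Type*} [Fintype X] [DecidableEq X] [Nonempty X] (w : X → X → ℝ) (r : ℝ) :
    Finset X :=
  open Classical in Finset.univ.filter fun x => r * maxRate w ≤ exitRate w x

/-- A rooted spanning forest of the weighted graph: a graph without cycles on all the vertices,
whose edges are edges of the weighted graph, with exactly one chosen vertex (the root) in each
connected component (tree). Orienting the edges toward the roots gives the spanning oriented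
forests; see `orientedEdges`. -/
@[ext]
structure SpanningForest {X : Type*} (w : X → X → ℝ) where
  graph : SimpleGraph X
  roots : Finset X
  acyclic : graph.IsAcyclic
  edge_pos : ∀ x y, graph.Adj x y → 0 < w x y
  existsUnique_root : ∀ c : graph.ConnectedComponent,
    ∃! r, r ∈ roots ∧ graph.connectedComponentMk r = c

instance {X : Type*} [Fintype X] (w : X → X → ℝ) : Finite (SpanningForest w) :=
  Finite.of_injective (fun φ : SpanningForest w => (φ.graph, φ.roots)) fun _ _ h =>
    SpanningForest.ext (congrArg Prod.fst h) (congrArg Prod.snd h)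

instance {X : Type*} [Fintype X] (w : X → X → ℝ) : Fintype (SpanningForest w) :=
  Fintype.ofFinite _

instance {X : Type*} (w : X → X → ℝ) : MeasurableSpace (SpanningForest w) := ⊤

/-- The edges of the forest, each oriented toward the root of its tree: `(x, y)` is an oriented
edge if `x, y` are adjacent and `y` is closer than `x` to the root of their tree. -/
def SpanningForest.orientedEdges {X : Type*} [Fintype X] {w : X → X → ℝ} (φ : SpanningForest w) :
    Finset (X × X) :=
  open Classical in Finset.univ.filter fun e =>
    φ.graph.Adj e.1 e.2 ∧
      ∃ r ∈ φ.roots, φ.graph.Reachable e.1 r ∧ φ.graph.dist e.2 r < φ.graph.dist e.1 r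

/-- The weight `w_q(φ) = q ^ |ρ(φ)| ∏_{e ∈ φ} w(e)`. -/
def SpanningForest.weight {X : Type*} [Fintype X] {w : X → X → ℝ} (q : ℝ)
    (φ : SpanningForest w) : ℝ :=
  q ^ φ.roots.card * ∏ e ∈ φ.orientedEdges, w e.1 e.2

/-- The partition function `Z(q)`. -/
def partitionFunction {X : Type*} [Fintype X] (w : X → X → ℝ) (q : ℝ) : ℝ :=
  ∑ φ : SpanningForest w, φ.weight q

/-- The law `π_q` on forests, `π_q(φ) = w_q(φ) / Z(q)`, as a measure. -/
def forestLaw {X : Type*} [Fintype X] (w : X → X → ℝ) (q : ℝ) : Measure (SpanningForest w) :=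
  ∑ φ : SpanningForest w, ENNReal.ofReal (φ.weight q / partitionFunction w q) • Measure.dirac φ

end

end RandomForest

/-!
For a vertex `x`, let `A(x)` and `B(x)` be the total weights of the forests in which `x` is,
respectively is not, a root, so that `Z = A(x) + B(x)` and `x` is a root with probability
`A(x) / Z`. The estimates come from a balance equation between `A(x)` and `B(x)`. In `w(x) A(x)`,
each forest `φ` rooted at `x` is paired with each vertex `y ≠ x` and carries the weight
`w(x, y) w_q(φ)`; there are two cases (`exitRate_mul_rootWeight`).

* If `y` lies in another tree, adding the oriented edge `(x, y)` yields a forest of weight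
  `w(x, y) w_q(φ) / q` in which `x` is not a root, and each such forest arises exactly once, since
  `y` is the head of its only oriented edge starting at `x`. These pairs contribute `q B(x)`
  (`sum_attachRoot`).
* If `y` lies in the tree of `x`, moving the root of this tree from `x` to `y` yields a forest `φ'`
  with `w(x, y) w_q(φ) = w(y, x) w_q(φ')` in which `x` is not a root, and `y` is recovered as the
  root of the tree of `x` (`sum_reroot`, `sum_root_ne`). As `w(y, x) ≤ α`, these pairs contribute
  at most `α B(x)`.

Both weight identities follow from reversibility. A forest has one oriented edge per unoriented
edge and one per vertex that is not a root, so with the conductances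
`c({x, y}) = μ(x) w(x, y)` the weight of a forest is, up to the factor `∏ μ`, the product of the
numbers `q μ(x)` over its roots and of the `c(e)` over its unoriented edges (`weight_mul_prod`).

Hence `q B(x) ≤ w(x) A(x) ≤ (q + α) B(x)`, and `w(x) ≤ α` gives
`A(x) / Z ≥ q / (q + α)` and `B(x) / Z ≥ w(x) / (q + 2 α)`. Summing these over all vertices or
over the rapid ones gives the three estimates. For the second one, `-L` is similar to a symmetric
matrix, so the sum of the roots of its characteristic polynomial is its trace `∑ w(x)`.
-/

/-! ### Distances and paths in acyclic graphs -/

namespace SimpleGraph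

variable {V : Type*} {G : SimpleGraph V}

lemma exists_isPath_notMem_support_of_dist_lt {x y r : V} (hr : G.Reachable y r)
    (hlt : G.dist y r < G.dist x r) : ∃ p : G.Walk y r, p.IsPath ∧ x ∉ p.support := by
  classical
  obtain ⟨p, hp, hlen⟩ := hr.exists_path_of_dist
  refine ⟨p, hp, fun hx => ?_⟩
  have h1 := dist_le (p.dropUntil x hx)
  have h2 := p.length_dropUntil_le_length hx
  omega

lemma IsAcyclic.length_eq_dist (hG : G.IsAcyclic) {x r : V} {p : G.Walk x r} (hp : p.IsPath) :
    p.length = G.dist x r := by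
  obtain ⟨p', hp', hlen⟩ := p.reachable.exists_path_of_dist
  have h := congrArg (fun p : G.Path x r => p.1.length)
    ((hG.subsingleton_path x r).elim ⟨p, hp⟩ ⟨p', hp'⟩)
  exact h.trans hlen

lemma IsAcyclic.dist_lt_of_notMem_support (hG : G.IsAcyclic) {x y r : V} (hxy : G.Adj x y)
    {p : G.Walk y r} (hp : p.IsPath) (hx : x ∉ p.support) : G.dist y r < G.dist x r := by
  have h1 := hG.length_eq_dist hp
  have h2 := hG.length_eq_dist ((Walk.cons_isPath_iff hxy p).2 ⟨hp, hx⟩)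
  rw [Walk.length_cons] at h2
  omega

/-- In an acyclic graph a vertex has at most one neighbour closer to a given vertex `r`: the two
paths to `r` through such neighbours coincide. -/
lemma IsAcyclic.eq_of_adj_of_dist_lt (hG : G.IsAcyclic) {x y z r : V} (hxy : G.Adj x y)
    (hxz : G.Adj x z) (hr : G.Reachable x r) (hy : G.dist y r < G.dist x r)
    (hz : G.dist z r < G.dist x r) : y = z := by
  obtain ⟨p, hp, hxp⟩ := exists_isPath_notMem_support_of_dist_lt
    (hxy.symm.reachable.trans hr) hy
  obtain ⟨p', hp', hxp'⟩ := exists_isPath_notMem_support_of_dist_lt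
    (hxz.symm.reachable.trans hr) hz
  have h := congrArg (fun p : G.Path x r => p.1.snd)
    ((hG.subsingleton_path x r).elim ⟨.cons hxy p, (Walk.cons_isPath_iff hxy p).2 ⟨hp, hxp⟩⟩
      ⟨.cons hxz p', (Walk.cons_isPath_iff hxz p').2 ⟨hp', hxp'⟩⟩)
  simpa using h

/-- Two vertices are linked after the addition of an edge `{x, y}` if they were linked before, or
if one was linked to `x` and the other one to `y`. -/
lemma Reachable.of_sup_edge {x y u v : V} (h : (G ⊔ edge x y).Reachable u v) :
    G.Reachable u v ∨ (G.Reachable u x ∧ G.Reachable y v) ∨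
      (G.Reachable u y ∧ G.Reachable x v) := by
  obtain ⟨p⟩ := h
  induction p with
  | nil => exact Or.inl .rfl
  | @cons a b c hab p ih =>
    rw [sup_adj, edge_adj] at hab
    rcases hab with hab | ⟨⟨rfl, rfl⟩ | ⟨rfl, rfl⟩, -⟩
    · have := hab.reachable
      rcases ih with h | ⟨h, h'⟩ | ⟨h, h'⟩
      · exact Or.inl (this.trans h)
      · exact Or.inr (Or.inl ⟨this.trans h, h'⟩)
      · exact Or.inr (Or.inr ⟨this.trans h, h'⟩)
    · rcases ih with h | ⟨h, h'⟩ | ⟨h, h'⟩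
      · exact Or.inr (Or.inl ⟨.rfl, h⟩)
      · exact Or.inr (Or.inl ⟨.rfl, h'⟩)
      · exact Or.inl h'
    · rcases ih with h | ⟨h, h'⟩ | ⟨h, h'⟩
      · exact Or.inr (Or.inr ⟨.rfl, h⟩)
      · exact Or.inl h'
      · exact Or.inr (Or.inr ⟨.rfl, h'⟩)

lemma deleteEdges_sup_edge {x y : V} (h : G.Adj x y) :
    G.deleteEdges {s(x, y)} ⊔ edge x y = G := by
  ext a b
  simp only [sup_adj, deleteEdges_adj, edge_adj, Set.mem_singleton_iff, Sym2.eq_iff]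
  have := h.symm
  have := h.ne
  constructor
  · rintro (h | ⟨⟨rfl, rfl⟩ | ⟨rfl, rfl⟩, -⟩)
    · exact h.1
    all_goals assumption
  · intro hab
    have := hab.ne
    tauto

end SimpleGraph

namespace RandomForest

namespace SpanningForest

/-! ### Roots and oriented edges of a forest -/

section Forest

variable {X : Type*} {w : X → X → ℝ}

lemma exists_root (φ : SpanningForest w) (x : X) : ∃ r ∈ φ.roots, φ.graph.Reachable x r := by
  obtain ⟨r, ⟨hr, h⟩, -⟩ := φ.existsUnique_root (φ.graph.connectedComponentMk x)
  exact ⟨r, hr, (SimpleGraph.ConnectedComponent.exact h).symm⟩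

lemma root_unique (φ : SpanningForest w) {r s : X} (hr : r ∈ φ.roots) (hs : s ∈ φ.roots)
    (h : φ.graph.Reachable r s) : r = s :=
  (φ.existsUnique_root (φ.graph.connectedComponentMk s)).unique
    ⟨hr, SimpleGraph.ConnectedComponent.sound h⟩ ⟨hs, rfl⟩

/-- A forest from an acyclic graph and a set of vertices that meets each tree exactly once, the
latter being phrased in terms of reachability. -/
def ofReachable (G : SimpleGraph X) (S : Finset X) (hG : G.IsAcyclic)
    (hw : ∀ x y, G.Adj x y → 0 < w x y) (hex : ∀ x, ∃ r ∈ S, G.Reachable x r)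
    (huniq : ∀ r ∈ S, ∀ s ∈ S, G.Reachable r s → r = s) : SpanningForest w where
  graph := G
  roots := S
  acyclic := hG
  edge_pos := hw
  existsUnique_root c := by
    induction c using SimpleGraph.ConnectedComponent.ind with
    | h x =>
      obtain ⟨r, hr, hxr⟩ := hex x
      refine ⟨r, ⟨hr, SimpleGraph.ConnectedComponent.sound hxr.symm⟩, fun s hs => ?_⟩
      exact huniq s hs.1 r hr ((SimpleGraph.ConnectedComponent.exact hs.2).trans hxr)

lemma notMem_roots_of_reachable {φ : SpanningForest w} {x y : X} (hx : x ∈ φ.roots)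
    (hxy : φ.graph.Reachable x y) (hne : x ≠ y) : y ∉ φ.roots :=
  fun hy => hne (φ.root_unique hx hy hxy)

variable [Fintype X]

lemma mem_orientedEdges {φ : SpanningForest w} {x y : X} :
    (x, y) ∈ φ.orientedEdges ↔ φ.graph.Adj x y ∧ ∃ r ∈ φ.roots, φ.graph.Reachable x r ∧
      φ.graph.dist y r < φ.graph.dist x r := by
  simp [orientedEdges]

lemma notMem_roots_of_mem_orientedEdges {φ : SpanningForest w} {x y : X}
    (h : (x, y) ∈ φ.orientedEdges) : x ∉ φ.roots := by
  obtain ⟨-, r, hr, hxr, hlt⟩ := mem_orientedEdges.1 h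
  intro hx
  rw [φ.root_unique hx hr hxr, SimpleGraph.dist_self] at hlt
  omega

lemma exists_mem_orientedEdges {φ : SpanningForest w} {x : X} (hx : x ∉ φ.roots) :
    ∃ y, (x, y) ∈ φ.orientedEdges := by
  obtain ⟨r, hr, hxr⟩ := φ.exists_root x
  obtain ⟨p, hp⟩ := hxr.exists_walk_length_eq_dist
  cases p with
  | nil => exact absurd hr hx
  | @cons _ y _ hxy p =>
    refine ⟨y, mem_orientedEdges.2 ⟨hxy, r, hr, hxr, ?_⟩⟩
    have := SimpleGraph.dist_le p
    rw [SimpleGraph.Walk.length_cons] at hp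
    omega

/-- Each vertex has at most one outgoing edge in an oriented forest. -/
lemma eq_of_mem_orientedEdges {φ : SpanningForest w} {x y z : X}
    (hy : (x, y) ∈ φ.orientedEdges) (hz : (x, z) ∈ φ.orientedEdges) : y = z := by
  obtain ⟨hxy, r, hr, hxr, hlt⟩ := mem_orientedEdges.1 hy
  obtain ⟨hxz, s, hs, hxs, hlt'⟩ := mem_orientedEdges.1 hz
  obtain rfl := φ.root_unique hr hs (hxr.symm.trans hxs)
  exact φ.acyclic.eq_of_adj_of_dist_lt hxy hxz hxr hlt hlt'

lemma mem_orientedEdges_or_swap {φ : SpanningForest w} {x y : X} (h : φ.graph.Adj x y) :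
    (x, y) ∈ φ.orientedEdges ∨ (y, x) ∈ φ.orientedEdges := by
  obtain ⟨r, hr, hxr⟩ := φ.exists_root x
  have hne := φ.acyclic.dist_ne_of_adj h hxr.symm
  rw [SimpleGraph.dist_comm, SimpleGraph.dist_comm (u := r)] at hne
  rcases lt_or_gt_of_ne hne with hlt | hlt
  · exact Or.inr (mem_orientedEdges.2
      ⟨h.symm, r, hr, h.symm.reachable.trans hxr, hlt⟩)
  · exact Or.inl (mem_orientedEdges.2 ⟨h, r, hr, hxr, hlt⟩)

lemma swap_notMem_orientedEdges {φ : SpanningForest w} {x y : X}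
    (h : (x, y) ∈ φ.orientedEdges) : (y, x) ∉ φ.orientedEdges := by
  intro h'
  obtain ⟨-, r, hr, hxr, hlt⟩ := mem_orientedEdges.1 h
  obtain ⟨hyx, s, hs, hys, hlt'⟩ := mem_orientedEdges.1 h'
  obtain rfl := φ.root_unique hr hs ((hyx.reachable.trans hxr).symm.trans hys)
  omega

end Forest

/-! ### The weight of a forest under reversibility -/

section Weight

variable {X : Type*} {w : X → X → ℝ}

/-- The conductance `c({x, y}) = μ(x) w(x, y)` of an unoriented edge. -/
def conductance {μ : X → ℝ} (hrev : ∀ x y, μ x * w x y = μ y * w y x) :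
    Sym2 X → ℝ :=
  Sym2.lift ⟨fun x y => μ x * w x y, hrev⟩

variable [Fintype X] {μ : X → ℝ}

open Classical in
/-- A forest has one oriented edge per unoriented edge and one per vertex that is not a root, its
tail. -/
lemma prod_orientedEdges_mul_prod_compl_roots (hrev : ∀ x y, μ x * w x y = μ y * w y x)
    (φ : SpanningForest w) :
    (∏ e ∈ φ.orientedEdges, w e.1 e.2) * ∏ x ∈ φ.rootsᶜ, μ x =
      ∏ e with e ∈ φ.graph.edgeSet, conductance hrev e := by
  have htail : ∏ x ∈ φ.rootsᶜ, μ x = ∏ e ∈ φ.orientedEdges, μ e.1 := by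
    refine (Finset.prod_bij (fun e _ => e.1) ?_ ?_ ?_ fun _ _ => rfl).symm
    · rintro ⟨x, y⟩ h
      simpa using notMem_roots_of_mem_orientedEdges h
    · rintro ⟨x, y⟩ h ⟨x', y'⟩ h' (rfl : x = x')
      rw [eq_of_mem_orientedEdges h h']
    · intro x hx
      obtain ⟨y, hy⟩ := exists_mem_orientedEdges (Finset.mem_compl.1 hx)
      exact ⟨_, hy, rfl⟩
  rw [htail, ← Finset.prod_mul_distrib]
  refine Finset.prod_bij (fun e _ => s(e.1, e.2)) ?_ ?_ ?_ ?_
  · rintro ⟨x, y⟩ h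
    simpa using (mem_orientedEdges.1 h).1
  · rintro ⟨x, y⟩ h ⟨x', y'⟩ h' heq
    rcases Sym2.eq_iff.1 heq with ⟨h1, h2⟩ | ⟨h1, h2⟩ <;> dsimp at h1 h2 <;> subst h1 h2
    · rfl
    · exact absurd h' (swap_notMem_orientedEdges h)
  · intro e he
    induction e using Sym2.ind with
    | h x y =>
      have hadj : φ.graph.Adj x y := by simpa using he
      rcases mem_orientedEdges_or_swap hadj with h | h
      · exact ⟨_, h, rfl⟩
      · exact ⟨_, h, Sym2.eq_swap⟩
  · rintro ⟨x, y⟩ -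
    exact mul_comm _ _

open Classical in
/-- Under reversibility, up to the constant factor `∏ μ`, the weight of a forest depends only on
the set of its roots and on the underlying unoriented graph. -/
lemma weight_mul_prod (hrev : ∀ x y, μ x * w x y = μ y * w y x) (q : ℝ) (φ : SpanningForest w) :
    φ.weight q * ∏ x, μ x =
      (∏ x ∈ φ.roots, q * μ x) * ∏ e with e ∈ φ.graph.edgeSet, conductance hrev e := by
  rw [← prod_orientedEdges_mul_prod_compl_roots hrev, ← Finset.prod_mul_prod_compl φ.roots,
    Finset.prod_mul_distrib, Finset.prod_const, weight]
  ring

end Weight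

/-! ### Attaching a tree by its root to another tree -/

section Attach

variable {X : Type*} [DecidableEq X] {w : X → X → ℝ}

/-- The forest obtained by adding an edge from a root `x` to a vertex `y` of another tree. -/
def attachRoot (φ : SpanningForest w) (x y : X) (hx : x ∈ φ.roots) (hxy : ¬φ.graph.Reachable x y)
    (hw : 0 < w x y) (hw' : 0 < w y x) : SpanningForest w :=
  ofReachable (φ.graph ⊔ SimpleGraph.edge x y) (φ.roots.erase x)
    (φ.acyclic.sup_edge_of_not_reachable hxy)
    (fun a b hab => by
      rw [SimpleGraph.sup_adj, SimpleGraph.edge_adj] at hab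
      rcases hab with hab | ⟨⟨rfl, rfl⟩ | ⟨rfl, rfl⟩, -⟩
      · exact φ.edge_pos a b hab
      all_goals assumption)
    (fun v => by
      have hne : x ≠ y := fun h => hxy (h ▸ .rfl)
      have hle : φ.graph ≤ φ.graph ⊔ SimpleGraph.edge x y := le_sup_left
      by_cases hv : φ.graph.Reachable v x
      · obtain ⟨r, hr, hyr⟩ := φ.exists_root y
        refine ⟨r, Finset.mem_erase.2 ⟨fun h => hxy (h ▸ hyr.symm), hr⟩, ?_⟩
        have hadj : (φ.graph ⊔ SimpleGraph.edge x y).Adj x y := by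
          simp [SimpleGraph.edge_adj, hne]
        exact (hv.mono hle).trans (hadj.reachable.trans (hyr.mono hle))
      · obtain ⟨r, hr, hvr⟩ := φ.exists_root v
        exact ⟨r, Finset.mem_erase.2 ⟨fun h => hv (h ▸ hvr), hr⟩, hvr.mono hle⟩)
    (fun r hr s hs hrs => by
      obtain ⟨hrx, hr⟩ := Finset.mem_erase.1 hr
      obtain ⟨hsx, hs⟩ := Finset.mem_erase.1 hs
      rcases hrs.of_sup_edge with h | ⟨h, -⟩ | ⟨-, h⟩
      · exact φ.root_unique hr hs h
      · exact absurd (φ.root_unique hr hx h) hrx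
      · exact absurd (φ.root_unique hx hs h).symm hsx)

lemma graph_attachRoot {φ : SpanningForest w} {x y : X} (hx : x ∈ φ.roots)
    (hxy : ¬φ.graph.Reachable x y) (hw : 0 < w x y) (hw' : 0 < w y x) :
    (φ.attachRoot x y hx hxy hw hw').graph = φ.graph ⊔ SimpleGraph.edge x y :=
  rfl

variable [Fintype X]

lemma mem_orientedEdges_attachRoot {φ : SpanningForest w} {x y : X} (hx : x ∈ φ.roots)
    (hxy : ¬φ.graph.Reachable x y) (hw : 0 < w x y) (hw' : 0 < w y x) :
    (x, y) ∈ (φ.attachRoot x y hx hxy hw hw').orientedEdges := by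
  have hne : x ≠ y := fun h => hxy (h ▸ .rfl)
  obtain ⟨r, hr, hyr⟩ := φ.exists_root y
  obtain ⟨p, hp⟩ := hyr.exists_isPath
  have hle : φ.graph ≤ (φ.attachRoot x y hx hxy hw hw').graph := le_sup_left
  have hadj : (φ.attachRoot x y hx hxy hw hw').graph.Adj x y :=
    SimpleGraph.sup_adj .. |>.2 (Or.inr (by simp [SimpleGraph.edge_adj, hne]))
  refine mem_orientedEdges.2 ⟨hadj, r, Finset.mem_erase.2 ⟨fun h => hxy (h ▸ hyr.symm), hr⟩,
    hadj.reachable.trans (hyr.mono hle), ?_⟩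
  refine (attachRoot ..).acyclic.dist_lt_of_notMem_support hadj (p := p.mapLe hle)
    (hp.mapLe hle) ?_
  rw [SimpleGraph.Walk.support_mapLe_eq_support]
  exact fun h => hxy (p.takeUntil x h).reachable.symm

/-- Every forest with an oriented edge from `x` to `y` arises by attaching the root `x` to `y`:
remove that edge and make `x` a root. -/
lemma exists_eq_attachRoot {φ : SpanningForest w} {x y : X} (h : (x, y) ∈ φ.orientedEdges) :
    ∃ (ψ : SpanningForest w) (hx : x ∈ ψ.roots) (hxy : ¬ψ.graph.Reachable x y)
      (hw : 0 < w x y) (hw' : 0 < w y x), φ = ψ.attachRoot x y hx hxy hw hw' := by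
  have hx := notMem_roots_of_mem_orientedEdges h
  obtain ⟨hadj, r, hr, hxr, hlt⟩ := mem_orientedEdges.1 h
  set G := φ.graph.deleteEdges {s(x, y)} with hG
  have hsup : G ⊔ SimpleGraph.edge x y = φ.graph := SimpleGraph.deleteEdges_sup_edge hadj
  have hle : G ≤ φ.graph := hsup ▸ le_sup_left
  have hnot : ¬G.Reachable x y := by
    have := SimpleGraph.isAcyclic_iff_forall_adj_isBridge.1 φ.acyclic hadj
    rwa [SimpleGraph.isBridge_iff] at this
  have hyr : G.Reachable y r := by
    obtain ⟨p, -, hp⟩ := SimpleGraph.exists_isPath_notMem_support_of_dist_lt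
      (hadj.symm.reachable.trans hxr) hlt
    exact ⟨p.toDeleteEdges _ fun e he hxe => hp
      (p.fst_mem_support_of_mem_edges (by rwa [Set.mem_singleton_iff.1 hxe] at he))⟩
  have key : ∀ s ∈ φ.roots, ¬G.Reachable x s := fun s hs hxs => by
    obtain rfl := φ.root_unique hs hr ((hxs.mono hle).symm.trans hxr)
    exact hnot (hxs.trans hyr.symm)
  let ψ : SpanningForest w := ofReachable G (insert x φ.roots) (φ.acyclic.anti hle)
    (fun a b hab => φ.edge_pos a b (hle hab))
    (fun v => by
      obtain ⟨s, hs, hvs⟩ := φ.exists_root v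
      rw [← hsup] at hvs
      rcases hvs.of_sup_edge with h | ⟨h, -⟩ | ⟨h, -⟩
      · exact ⟨s, Finset.mem_insert_of_mem hs, h⟩
      · exact ⟨x, Finset.mem_insert_self _ _, h⟩
      · exact ⟨r, Finset.mem_insert_of_mem hr, h.trans hyr⟩)
    (fun s hs t ht hst => by
      rw [Finset.mem_insert] at hs ht
      rcases hs with hs | hs <;> rcases ht with ht | ht
      · exact hs.trans ht.symm
      · exact absurd (hs ▸ hst) (key t ht)
      · exact absurd (ht ▸ hst).symm (key s hs)
      · exact φ.root_unique hs ht (hst.mono hle))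
  refine ⟨ψ, Finset.mem_insert_self _ _, hnot, φ.edge_pos _ _ hadj, φ.edge_pos _ _ hadj.symm, ?_⟩
  ext1
  · exact hsup.symm
  · exact (Finset.erase_insert hx).symm

lemma weight_attachRoot_mul {μ : X → ℝ} (hμ : ∀ x, 0 < μ x)
    (hrev : ∀ x y, μ x * w x y = μ y * w y x) {q : ℝ}
    {φ : SpanningForest w} {x y : X} (hx : x ∈ φ.roots)
    (hxy : ¬φ.graph.Reachable x y) (hw : 0 < w x y) (hw' : 0 < w y x) :
    q * (φ.attachRoot x y hx hxy hw hw').weight q = w x y * φ.weight q := by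
  classical
  have hne : x ≠ y := fun h => hxy (h ▸ .rfl)
  have h1 := weight_mul_prod hrev q φ
  have h2 := weight_mul_prod hrev q (φ.attachRoot x y hx hxy hw hw')
  have hedges : (Finset.univ.filter fun e => e ∈ (φ.attachRoot x y hx hxy hw hw').graph.edgeSet) =
      insert s(x, y) (Finset.univ.filter fun e => e ∈ φ.graph.edgeSet) := by
    ext e
    rw [graph_attachRoot]
    simp [SimpleGraph.edgeSet_sup, SimpleGraph.edgeSet_edge_of_ne hne]
  have hnotin : s(x, y) ∉ Finset.univ.filter fun e => e ∈ φ.graph.edgeSet := by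
    simpa using fun h : φ.graph.Adj x y => hxy h.reachable
  rw [hedges, Finset.prod_insert hnotin] at h2
  change _ = (∏ z ∈ φ.roots.erase x, q * μ z) * (μ x * w x y * _) at h2
  rw [← Finset.mul_prod_erase _ _ hx] at h1
  have hpos : 0 < μ x * ∏ z, μ z := mul_pos (hμ x) (Finset.prod_pos fun z _ => hμ z)
  refine mul_right_cancel₀ hpos.ne' ?_
  linear_combination q * μ x * h2 - w x y * μ x * h1

end Attach

/-! ### Changing the root of a tree -/

section Reroot

variable {X : Type*} [DecidableEq X] {w : X → X → ℝ}

/-- The forest obtained by moving the root of a tree from `x` to `y`. -/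
def reroot (φ : SpanningForest w) (x y : X) (hx : x ∈ φ.roots) (hxy : φ.graph.Reachable x y) :
    SpanningForest w :=
  ofReachable φ.graph (insert y (φ.roots.erase x)) φ.acyclic φ.edge_pos
    (fun v => by
      obtain ⟨r, hr, hvr⟩ := φ.exists_root v
      by_cases h : r = x
      · exact ⟨y, Finset.mem_insert_self _ _, (h ▸ hvr).trans hxy⟩
      · exact ⟨r, Finset.mem_insert_of_mem (Finset.mem_erase.2 ⟨h, hr⟩), hvr⟩)
    (fun r hr s hs hrs => by
      rw [Finset.mem_insert, Finset.mem_erase] at hr hs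
      rcases hr with rfl | ⟨hrx, hr⟩ <;> rcases hs with rfl | ⟨hsx, hs⟩
      · rfl
      · exact absurd (φ.root_unique hx hs (hxy.trans hrs)).symm hsx
      · exact absurd (φ.root_unique hx hr (hxy.trans hrs.symm)).symm hrx
      · exact φ.root_unique hr hs hrs)

lemma reroot_reroot {φ : SpanningForest w} {x y : X} (hx : x ∈ φ.roots)
    (hxy : φ.graph.Reachable x y) (hne : x ≠ y) :
    (φ.reroot x y hx hxy).reroot y x (Finset.mem_insert_self _ _) hxy.symm = φ := by
  have hy := notMem_roots_of_reachable hx hxy hne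
  ext1
  · rfl
  · change insert x ((insert y (φ.roots.erase x)).erase y) = φ.roots
    rw [Finset.erase_insert (fun h => hy (Finset.mem_of_mem_erase h)), Finset.insert_erase hx]

lemma mul_weight_reroot [Fintype X] {μ : X → ℝ} (hμ : ∀ x, 0 < μ x)
    (hrev : ∀ x y, μ x * w x y = μ y * w y x) {q : ℝ} {φ : SpanningForest w} {x y : X}
    (hx : x ∈ φ.roots) (hxy : φ.graph.Reachable x y) (hne : x ≠ y) :
    w y x * (φ.reroot x y hx hxy).weight q = w x y * φ.weight q := by
  classical
  have hy := notMem_roots_of_reachable hx hxy hne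
  have h1 := weight_mul_prod hrev q φ
  have h2 := weight_mul_prod hrev q (φ.reroot x y hx hxy)
  change _ = (∏ z ∈ insert y (φ.roots.erase x), q * μ z) *
    ∏ e with e ∈ φ.graph.edgeSet, _ at h2
  rw [Finset.prod_insert (fun h => hy (Finset.mem_of_mem_erase h))] at h2
  rw [← Finset.mul_prod_erase _ _ hx] at h1
  have hpos : 0 < μ x * ∏ z, μ z := mul_pos (hμ x) (Finset.prod_pos fun z _ => hμ z)
  refine mul_right_cancel₀ hpos.ne' ?_
  set A := ∏ z ∈ φ.roots.erase x, q * μ z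
  set B := ∏ e with e ∈ φ.graph.edgeSet, conductance hrev e
  linear_combination w y x * μ x * h2 - w x y * μ x * h1 - q * μ x * A * B * hrev x y

end Reroot

end SpanningForest

/-! ### Balance of the weights of forests -/

section Balance

lemma rate_pos_symm {X : Type*} {w : X → X → ℝ} {μ : X → ℝ} (hμ : ∀ x, 0 < μ x)
    (hrev : ∀ x y, μ x * w x y = μ y * w y x) {x y : X} (h : 0 < w x y) : 0 < w y x :=
  (mul_pos_iff_of_pos_left (hμ y)).1 (hrev x y ▸ mul_pos (hμ x) h)

variable {X : Type*} [Fintype X] {w : X → X → ℝ}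

namespace SpanningForest

lemma weight_pos {q : ℝ} (hq : 0 < q) (φ : SpanningForest w) : 0 < φ.weight q :=
  mul_pos (pow_pos hq _) (Finset.prod_pos fun _ h => φ.edge_pos _ _ (mem_orientedEdges.1 h).1)

instance : Nonempty (SpanningForest w) :=
  ⟨ofReachable ⊥ Finset.univ SimpleGraph.isAcyclic_bot (fun _ _ h => h.elim)
    (fun x => ⟨x, Finset.mem_univ x, .rfl⟩)
    (fun _ _ _ _ h => SimpleGraph.reachable_bot.1 h)⟩

end SpanningForest

lemma partitionFunction_pos {q : ℝ} (hq : 0 < q) : 0 < partitionFunction w q :=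
  Finset.sum_pos (fun φ _ => φ.weight_pos hq) Finset.univ_nonempty

variable [DecidableEq X]

open Classical in
/-- The total weight of the forests in which `x` is a root. -/
noncomputable def rootWeight (w : X → X → ℝ) (q : ℝ) (x : X) : ℝ :=
  ∑ φ : SpanningForest w with x ∈ φ.roots, φ.weight q

open Classical in
/-- The total weight of the forests in which `x` is not a root. -/
noncomputable def nonrootWeight (w : X → X → ℝ) (q : ℝ) (x : X) : ℝ :=
  ∑ φ : SpanningForest w with x ∉ φ.roots, φ.weight q

lemma rootWeight_add_nonrootWeight (q : ℝ) (x : X) :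
    rootWeight w q x + nonrootWeight w q x = partitionFunction w q := by
  classical
  exact Finset.sum_filter_add_sum_filter_not _ _ _

lemma nonrootWeight_nonneg {q : ℝ} (hq : 0 < q) (x : X) : 0 ≤ nonrootWeight w q x :=
  Finset.sum_nonneg fun φ _ => (φ.weight_pos hq).le

variable {μ : X → ℝ}

open Classical in
/-- Attaching the root `x` to the vertices of other trees produces each forest in which `x` is
not a root exactly once. -/
lemma sum_attachRoot (hw : ∀ x y, 0 ≤ w x y) (hμ : ∀ x, 0 < μ x)
    (hrev : ∀ x y, μ x * w x y = μ y * w y x) {q : ℝ} (hq : 0 < q) (x : X) :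
    ∑ p : SpanningForest w × X with x ∈ p.1.roots ∧ ¬p.1.graph.Reachable x p.2,
      w x p.2 * p.1.weight q = q * nonrootWeight w q x := by
  rw [nonrootWeight, Finset.mul_sum]
  have hpos : ∀ p : SpanningForest w × X, w x p.2 * p.1.weight q ≠ 0 → 0 < w x p.2 :=
    fun p h => (hw _ _).lt_of_ne' (left_ne_zero_of_mul h)
  refine Finset.sum_bij_ne_zero
    (fun p hp h0 => p.1.attachRoot x p.2 (Finset.mem_filter.1 hp).2.1 (Finset.mem_filter.1 hp).2.2
      (hpos p h0) (rate_pos_symm hμ hrev (hpos p h0))) ?_ ?_ ?_ ?_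
  · intro p hp h0
    simpa using SpanningForest.notMem_roots_of_mem_orientedEdges
      (SpanningForest.mem_orientedEdges_attachRoot _ _ _ _)
  · rintro ⟨φ, y⟩ hp h0 ⟨ψ, z⟩ hp' h0' heq
    dsimp only at heq
    obtain ⟨-, hx, hxy⟩ := Finset.mem_filter.1 hp
    obtain ⟨-, hx', hxz⟩ := Finset.mem_filter.1 hp'
    -- The vertex to which `x` was attached is the head of the oriented edge starting at `x`.
    have hyz : y = z := by
      have hz := SpanningForest.mem_orientedEdges_attachRoot hx' hxz (hpos _ h0')
        (rate_pos_symm hμ hrev (hpos _ h0'))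
      rw [← heq] at hz
      exact SpanningForest.eq_of_mem_orientedEdges
        (SpanningForest.mem_orientedEdges_attachRoot _ _ _ _) hz
    subst hyz
    have hg := congrArg (fun φ => φ.graph.deleteEdges {s(x, y)}) heq
    have hr := congrArg (fun φ => insert x φ.roots) heq
    dsimp only [SpanningForest.graph_attachRoot] at hg
    change insert x (φ.roots.erase x) = insert x (ψ.roots.erase x) at hr
    rw [Finset.insert_erase hx, Finset.insert_erase hx'] at hr
    have hdel : ∀ χ : SpanningForest w, ¬χ.graph.Reachable x y →
        (χ.graph ⊔ SimpleGraph.edge x y).deleteEdges {s(x, y)} = χ.graph := fun χ h => by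
      have : ¬χ.graph.Adj x y := fun h' => h h'.reachable
      simp [SimpleGraph.deleteEdges_sup, this]
    rw [hdel φ hxy, hdel ψ hxz] at hg
    exact Prod.ext (SpanningForest.ext hg hr) rfl
  · intro φ hφ h0
    obtain ⟨y, hy⟩ := SpanningForest.exists_mem_orientedEdges (Finset.mem_filter.1 hφ).2
    obtain ⟨ψ, hx, hxy, hwxy, hwyx, rfl⟩ := SpanningForest.exists_eq_attachRoot hy
    exact ⟨(ψ, y), by simp [hx, hxy], mul_ne_zero hwxy.ne' (ψ.weight_pos hq).ne', rfl⟩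
  · intro p hp h0
    exact (SpanningForest.weight_attachRoot_mul hμ hrev _ _ _ _).symm

open Classical in
/-- Moving the root of the tree of `x` from `x` to another vertex `y` amounts to exchanging
`w(x, y)` and `w(y, x)`. -/
lemma sum_reroot (hμ : ∀ x, 0 < μ x) (hrev : ∀ x y, μ x * w x y = μ y * w y x) (q : ℝ) (x : X) :
    ∑ p : SpanningForest w × X with x ∈ p.1.roots ∧ p.1.graph.Reachable x p.2 ∧ x ≠ p.2,
        w x p.2 * p.1.weight q =
      ∑ p : SpanningForest w × X with p.2 ∈ p.1.roots ∧ p.1.graph.Reachable x p.2 ∧ x ≠ p.2,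
        w p.2 x * p.1.weight q := by
  refine Finset.sum_bij'
    (fun p hp => (p.1.reroot x p.2 (Finset.mem_filter.1 hp).2.1 (Finset.mem_filter.1 hp).2.2.1,
      p.2))
    (fun p hp => (p.1.reroot p.2 x (Finset.mem_filter.1 hp).2.1
      (Finset.mem_filter.1 hp).2.2.1.symm, p.2)) ?_ ?_ ?_ ?_ ?_
  · intro p hp
    obtain ⟨-, -, h, hne⟩ := Finset.mem_filter.1 hp
    exact Finset.mem_filter.2 ⟨Finset.mem_univ _, Finset.mem_insert_self _ _, h, hne⟩
  · intro p hp
    obtain ⟨-, -, h, hne⟩ := Finset.mem_filter.1 hp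
    exact Finset.mem_filter.2 ⟨Finset.mem_univ _, Finset.mem_insert_self _ _, h, hne⟩
  · intro p hp
    obtain ⟨-, hx, h, hne⟩ := Finset.mem_filter.1 hp
    exact Prod.ext (SpanningForest.reroot_reroot hx h hne) rfl
  · intro p hp
    obtain ⟨-, hx, h, hne⟩ := Finset.mem_filter.1 hp
    exact Prod.ext (SpanningForest.reroot_reroot hx h.symm hne.symm) rfl
  · intro p hp
    obtain ⟨-, hx, h, hne⟩ := Finset.mem_filter.1 hp
    exact (SpanningForest.mul_weight_reroot hμ hrev hx h hne).symm

open Classical in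
/-- If `x` is not a root then its tree has exactly one root, which differs from `x`. -/
lemma sum_root_ne (q : ℝ) (x : X) :
    ∑ p : SpanningForest w × X with p.2 ∈ p.1.roots ∧ p.1.graph.Reachable x p.2 ∧ x ≠ p.2,
      p.1.weight q = nonrootWeight w q x := by
  refine Finset.sum_bij (fun p _ => p.1) ?_ ?_ ?_ fun _ _ => rfl
  · intro p hp
    obtain ⟨-, hr, h, hne⟩ := Finset.mem_filter.1 hp
    simpa using SpanningForest.notMem_roots_of_reachable hr h.symm hne.symm
  · rintro ⟨φ, y⟩ hp ⟨ψ, z⟩ hp' (rfl : φ = ψ)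
    obtain ⟨-, hr, h, -⟩ := Finset.mem_filter.1 hp
    obtain ⟨-, hr', h', -⟩ := Finset.mem_filter.1 hp'
    exact Prod.ext rfl (φ.root_unique hr hr' (h.symm.trans h'))
  · intro φ hφ
    obtain ⟨r, hr, hxr⟩ := φ.exists_root x
    have hx := (Finset.mem_filter.1 hφ).2
    exact ⟨(φ, r), by simpa [hr, hxr] using fun h : x = r => hx (h ▸ hr), rfl⟩

open Classical in
/-- The pairs of a forest rooted at `x` and a vertex `y ≠ x` are split according to whether `y` lies
in the tree of `x`. -/
lemma exitRate_mul_rootWeight (q : ℝ) (x : X) :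
    exitRate w x * rootWeight w q x =
      ∑ p : SpanningForest w × X with x ∈ p.1.roots ∧ ¬p.1.graph.Reachable x p.2,
          w x p.2 * p.1.weight q +
        ∑ p : SpanningForest w × X with x ∈ p.1.roots ∧ p.1.graph.Reachable x p.2 ∧ x ≠ p.2,
          w x p.2 * p.1.weight q := by
  rw [← Finset.sum_union, mul_comm, rootWeight, exitRate, Finset.sum_mul_sum,
    ← Finset.sum_product']
  · refine Finset.sum_congr ?_ fun p _ => mul_comm _ _
    ext p
    have : ¬p.1.graph.Reachable x p.2 → p.2 ≠ x := fun h h' => h (h' ▸ .rfl)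
    simp only [Finset.mem_product, Finset.mem_filter, Finset.mem_univ, Finset.mem_erase,
      Finset.mem_union, true_and, and_true]
    have := ne_comm (a := x) (b := p.2)
    tauto
  · rw [Finset.disjoint_filter]
    rintro p - ⟨-, h⟩ ⟨-, h', -⟩
    exact h h'

lemma exitRate_nonneg (hw : ∀ x y, 0 ≤ w x y) (x : X) : 0 ≤ exitRate w x :=
  Finset.sum_nonneg fun _ _ => hw _ _

lemma mul_nonrootWeight_le (hw : ∀ x y, 0 ≤ w x y) (hμ : ∀ x, 0 < μ x)
    (hrev : ∀ x y, μ x * w x y = μ y * w y x) {q : ℝ} (hq : 0 < q) (x : X) :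
    q * nonrootWeight w q x ≤ exitRate w x * rootWeight w q x := by
  rw [exitRate_mul_rootWeight, sum_attachRoot hw hμ hrev hq]
  exact le_add_of_nonneg_right
    (Finset.sum_nonneg fun p _ => mul_nonneg (hw _ _) (p.1.weight_pos hq).le)

variable [Nonempty X]

lemma exitRate_le_maxRate (x : X) : exitRate w x ≤ maxRate w :=
  Finset.le_sup' (exitRate w) (Finset.mem_univ x)

lemma maxRate_nonneg (hw : ∀ x y, 0 ≤ w x y) : 0 ≤ maxRate w :=
  (exitRate_nonneg hw (Classical.arbitrary X)).trans (exitRate_le_maxRate _)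

lemma rate_le_maxRate (hw : ∀ x y, 0 ≤ w x y) {x y : X} (h : x ≠ y) : w x y ≤ maxRate w :=
  (Finset.single_le_sum (fun z _ => hw x z)
    (Finset.mem_erase.2 ⟨h.symm, Finset.mem_univ y⟩)).trans (exitRate_le_maxRate x)

open Classical in
lemma exitRate_mul_rootWeight_le (hw : ∀ x y, 0 ≤ w x y) (hμ : ∀ x, 0 < μ x)
    (hrev : ∀ x y, μ x * w x y = μ y * w y x) {q : ℝ} (hq : 0 < q) (x : X) :
    exitRate w x * rootWeight w q x ≤ (q + maxRate w) * nonrootWeight w q x := by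
  rw [exitRate_mul_rootWeight, sum_attachRoot hw hμ hrev hq, sum_reroot hμ hrev, add_mul]
  gcongr
  rw [← sum_root_ne, Finset.mul_sum]
  refine Finset.sum_le_sum fun p hp => ?_
  exact mul_le_mul_of_nonneg_right (rate_le_maxRate hw (Finset.mem_filter.1 hp).2.2.2.symm)
    (p.1.weight_pos hq).le

/-- The probability that `x` is a root is at least `q / (q + α)`. -/
lemma div_le_rootWeight_div (hw : ∀ x y, 0 ≤ w x y) (hμ : ∀ x, 0 < μ x)
    (hrev : ∀ x y, μ x * w x y = μ y * w y x) {q : ℝ} (hq : 0 < q) (x : X) :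
    q / (q + maxRate w) ≤ rootWeight w q x / partitionFunction w q := by
  have h1 := mul_nonrootWeight_le hw hμ hrev hq x
  have h2 := rootWeight_add_nonrootWeight (w := w) q x
  have h3 : exitRate w x * rootWeight w q x ≤ maxRate w * rootWeight w q x :=
    mul_le_mul_of_nonneg_right (exitRate_le_maxRate x)
      (Finset.sum_nonneg fun φ _ => (φ.weight_pos hq).le)
  have hα := maxRate_nonneg hw
  rw [div_le_div_iff₀ (by linarith) (partitionFunction_pos hq)]
  linear_combination h1 + h3 - q * h2

/-- The probability that `x` is not a root is at least `w(x) / (q + 2 α)`. -/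
lemma exitRate_div_le_nonrootWeight_div (hw : ∀ x y, 0 ≤ w x y) (hμ : ∀ x, 0 < μ x)
    (hrev : ∀ x y, μ x * w x y = μ y * w y x) {q : ℝ} (hq : 0 < q) (x : X) :
    exitRate w x / (q + 2 * maxRate w) ≤ nonrootWeight w q x / partitionFunction w q := by
  have h1 := exitRate_mul_rootWeight_le hw hμ hrev hq x
  have h2 := rootWeight_add_nonrootWeight (w := w) q x
  have h3 : exitRate w x * nonrootWeight w q x ≤ maxRate w * nonrootWeight w q x :=
    mul_le_mul_of_nonneg_right (exitRate_le_maxRate x) (nonrootWeight_nonneg hq x)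
  have hα := maxRate_nonneg hw
  rw [div_le_div_iff₀ (by linarith) (partitionFunction_pos hq)]
  linear_combination h1 + h3 - exitRate w x * h2

end Balance

/-! ### Positivity of the reversible measure -/

/-- The positivity of the reversible measure propagates along the jumps of positive rate. -/
lemma reversible_pos {X : Type*} [Fintype X] {w : X → X → ℝ} {μ : X → ℝ}
    (hμ : ∀ x, 0 ≤ μ x) (hμ_sum : ∑ x, μ x = 1)
    (hrev : ∀ x y, μ x * w x y = μ y * w y x) (hirr : IsIrreducible w) (x : X) : 0 < μ x := by
  obtain ⟨x₀, -, h₀⟩ : ∃ x₀ ∈ Finset.univ, 0 < μ x₀ :=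
    Finset.exists_lt_of_sum_lt (by simp [hμ_sum])
  induction hirr x₀ x with
  | refl => exact h₀
  | @tail a b _ hab ih =>
    have h : 0 < μ b * w b a := hrev a b ▸ mul_pos ih hab
    exact (hμ b).lt_of_ne' (left_ne_zero_of_mul h.ne')

/-! ### The trace of the generator -/

section Trace

variable {X : Type*} [Fintype X] [DecidableEq X]

/-- A real matrix satisfying detailed balance is similar, by conjugation with `diag(√μ)`, to a
symmetric one. -/
lemma splits_charpoly_of_reversible {A : Matrix X X ℝ} {μ : X → ℝ} (hμ : ∀ x, 0 < μ x)
    (hA : ∀ x y, μ x * A x y = μ y * A y x) : A.charpoly.Splits := by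
  have hs : ∀ x, √(μ x) ≠ 0 := fun x => (Real.sqrt_pos.2 (hμ x)).ne'
  let D : (Matrix X X ℝ)ˣ :=
    ⟨.diagonal fun x => √(μ x), .diagonal fun x => (√(μ x))⁻¹,
      by simp [Matrix.diagonal_mul_diagonal, hs], by simp [Matrix.diagonal_mul_diagonal, hs]⟩
  have hB : (D.val * A * (D⁻¹ : (Matrix X X ℝ)ˣ).val).IsHermitian := by
    refine Matrix.IsHermitian.ext fun x y => ?_
    change star ((Matrix.diagonal (fun x => √(μ x)) * A *
      Matrix.diagonal fun x => (√(μ x))⁻¹) y x) = (Matrix.diagonal (fun x => √(μ x)) * A *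
      Matrix.diagonal fun x => (√(μ x))⁻¹) x y
    rw [Matrix.mul_diagonal, Matrix.mul_diagonal, Matrix.diagonal_mul, Matrix.diagonal_mul,
      star_trivial]
    have h1 := Real.mul_self_sqrt (hμ x).le
    have h2 := Real.mul_self_sqrt (hμ y).le
    have h3 := hA x y
    have := hs x
    have := hs y
    field_simp
    rw [Real.sq_sqrt (hμ x).le, Real.sq_sqrt (hμ y).le]
    linarith
  rw [← Matrix.charpoly_units_conj D A, ← Matrix.coe_units_inv]
  exact hB.splits_charpoly

lemma sum_roots_charpoly_neg_generator {w : X → X → ℝ} {μ : X → ℝ} (hμ : ∀ x, 0 < μ x)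
    (hrev : ∀ x y, μ x * w x y = μ y * w y x) :
    (-generator w).charpoly.roots.sum = ∑ x, exitRate w x := by
  rw [← Matrix.trace_eq_sum_roots_charpoly_of_splits (splits_charpoly_of_reversible hμ ?_)]
  · simp [Matrix.trace, generator]
  · intro x y
    by_cases h : x = y
    · rw [h]
    · simp [generator, h, Ne.symm h, hrev x y]

lemma maxRate_mul_card_mul_meanEigenvalue [Nonempty X] {w : X → X → ℝ} {μ : X → ℝ}
    (hw : ∀ x y, 0 ≤ w x y) (hμ : ∀ x, 0 < μ x) (hrev : ∀ x y, μ x * w x y = μ y * w y x) :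
    maxRate w * (Fintype.card X * meanEigenvalue w) = ∑ x, exitRate w x := by
  rcases eq_or_ne (maxRate w) 0 with h | h
  -- If `α = 0` then all rates of escape vanish, so both sides do.
  · have : ∀ x, exitRate w x = 0 := fun x =>
      le_antisymm (h ▸ exitRate_le_maxRate x) (exitRate_nonneg hw x)
    simp [h, this]
  · have hn : (Fintype.card X : ℝ) ≠ 0 := Nat.cast_ne_zero.2 Fintype.card_ne_zero
    rw [meanEigenvalue, Multiset.sum_map_div, Multiset.map_id',
      sum_roots_charpoly_neg_generator hμ hrev]
    field_simp

end Trace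

/-! ### Expectations under the forest law -/

open Classical in
lemma integral_card_eq_sum {X : Type*} [Fintype X] [DecidableEq X] {w : X → X → ℝ} {q : ℝ}
    (hq : 0 < q) {Ω : Type*} [MeasurableSpace Ω] {P : Measure Ω} {Φ : Ω → SpanningForest w}
    (hΦ : HasLaw Φ (forestLaw w q) P) (s : SpanningForest w → Finset X) :
    ∫ ω, ((s (Φ ω)).card : ℝ) ∂P =
      ∑ x, (∑ φ with x ∈ s φ, φ.weight q) / partitionFunction w q := by
  have hmeas : Measurable fun φ => ((s φ).card : ℝ) := measurable_from_top
  have : MeasurableSingletonClass (SpanningForest w) := ⟨fun _ => trivial⟩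
  refine (hΦ.integral_comp (f := fun φ => ((s φ).card : ℝ))
    hmeas.aestronglyMeasurable).trans ?_
  rw [forestLaw, integral_finsetSum_measure fun φ _ =>
    (integrable_dirac (by simp)).smul_measure ENNReal.ofReal_ne_top]
  have hZ := partitionFunction_pos (w := w) hq
  simp_rw [integral_smul_measure, integral_dirac,
    ENNReal.toReal_ofReal (div_nonneg (SpanningForest.weight_pos hq _).le hZ.le), smul_eq_mul,
    ← Finset.sum_div, Finset.sum_filter]
  rw [Finset.sum_comm, Finset.sum_div]
  refine Finset.sum_congr rfl fun φ _ => ?_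
  rw [Finset.sum_ite_mem, Finset.univ_inter, Finset.sum_const, nsmul_eq_mul]
  ring

end RandomForest

theorem mainTheorem6 {X : Type*} [Fintype X] [DecidableEq X] [Nontrivial X]
    (w : X → X → ℝ) (μ : X → ℝ)
    (hw : ∀ x y, 0 ≤ w x y)
    (hμ : ∀ x, 0 ≤ μ x) (hμ_sum : ∑ x, μ x = 1)
    (hrev : ∀ x y, μ x * w x y = μ y * w y x)
    (hirr : RandomForest.IsIrreducible w)
    (q : ℝ) (hq : 0 < q)
    {Ω : Type*} [MeasurableSpace Ω] (P : Measure Ω) [IsProbabilityMeasure P]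
    (Φ : Ω → RandomForest.SpanningForest w)
    (hΦ : HasLaw Φ (RandomForest.forestLaw w q) P) :
    (Fintype.card X : ℝ) * (q / (q + RandomForest.maxRate w))
        ≤ ∫ ω, ((Φ ω).roots.card : ℝ) ∂P ∧
    (Fintype.card X : ℝ) * (RandomForest.maxRate w / (q + 2 * RandomForest.maxRate w)) *
          RandomForest.meanEigenvalue w
        ≤ ∫ ω, (((Φ ω).rootsᶜ).card : ℝ) ∂P ∧
    ∀ r ∈ Set.Icc (0 : ℝ) 1,
      ((RandomForest.rapidPoints w r).card : ℝ) *
          (r * RandomForest.maxRate w / (q + 2 * RandomForest.maxRate w))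
        ≤ ∫ ω, (((Φ ω).rootsᶜ ∩ RandomForest.rapidPoints w r).card : ℝ) ∂P := by
  classical
  have hμ' := RandomForest.reversible_pos hμ hμ_sum hrev hirr
  have hα := RandomForest.maxRate_nonneg hw
  have hnonroot := RandomForest.exitRate_div_le_nonrootWeight_div hw hμ' hrev hq
  refine ⟨?_, ?_, fun r _ => ?_⟩
  · rw [RandomForest.integral_card_eq_sum hq hΦ fun φ => φ.roots, ← nsmul_eq_mul,
      ← Finset.card_univ]
    refine Finset.card_nsmul_le_sum _ _ _ fun x _ => ?_
    exact RandomForest.div_le_rootWeight_div hw hμ' hrev hq x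
  · rw [RandomForest.integral_card_eq_sum hq hΦ fun φ => φ.rootsᶜ]
    calc _ = RandomForest.maxRate w * (Fintype.card X * RandomForest.meanEigenvalue w) /
          (q + 2 * RandomForest.maxRate w) := by ring
      _ = ∑ x, RandomForest.exitRate w x / (q + 2 * RandomForest.maxRate w) := by
        rw [RandomForest.maxRate_mul_card_mul_meanEigenvalue hw hμ' hrev, Finset.sum_div]
      _ ≤ _ := by
        refine Finset.sum_le_sum fun x _ => (hnonroot x).trans_eq ?_
        simp_rw [Finset.mem_compl, RandomForest.nonrootWeight]
  · rw [RandomForest.integral_card_eq_sum hq hΦ fun φ => φ.rootsᶜ ∩ RandomForest.rapidPoints w r,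
      ← nsmul_eq_mul]
    refine (Finset.card_nsmul_le_sum _ _ _ fun x hx => ?_).trans
      (Finset.sum_le_univ_sum_of_nonneg fun x => ?_)
    · have hr : r * RandomForest.maxRate w ≤ RandomForest.exitRate w x :=
        (Finset.mem_filter.1 hx).2
      refine (div_le_div_of_nonneg_right hr (by linarith)).trans ((hnonroot x).trans_eq ?_)
      simp_rw [Finset.mem_inter, Finset.mem_compl, hx, and_true, RandomForest.nonrootWeight]
    · exact div_nonneg (Finset.sum_nonneg fun φ _ => (φ.weight_pos hq).le)
        (RandomForest.partitionFunction_pos hq).le
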